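/- Let $N\ge 1$ and $d\ge N$, let $\mathcal H_1$ be a $d$-dimensional complex Hilbert space, $\mathcal H_N=\wedge^N\mathcal H_1$ the $N$-fermion Hilbert space (the antisymmetric tensors in $\mathcal H_1^{\otimes N}$), and $D=\dim\mathcal H_N$. For a vector $w\in\mathbb R^D$ let $\mathcal E^N(w)$ be the set of density operators on $\mathcal H_N$ (positive semidefinite, trace one) whose eigenvalues, counted with multiplicity, are the entries of $w$. Let $\mathcal E^1_N(w)=N\,\mathrm{Tr}_{N-1}[\mathcal E^N(w)]$ be the set of their one-particle reduced density operators, where $\mathrm{Tr}_{N-1}$ is the partial trace over $N-1$ of the $N$ particles. Let $\Sigma(w)\subset\mathbb R^d$ be the set of all vectors listing, in any order, the eigenvalues (with multiplicity) of an operator $\gamma$ in the convex hull of $\mathcal E^1_N(w)$. For $v\in\mathbb R^d$ let $v^\downarrow$ be its decreasing rearrangement, and write $v\prec u$ ($v$ is majorized by $u$) if $\sum_{j\le k}v^\downarrow_j\le\sum_{j\le k}u^\downarrow_j$ for $k=1,\dots,d$ and $\sum_j v_j=\sum_j u_j$. (r = 2) Let $d\ge N+1$ and $w=(w_1,w_2,0,\dots,0)$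 with $w_1\ge w_2\ge 0$ and $w_1+w_2=1$. Then $$\Sigma(w)=\{\lambda\in\mathbb R^d:\ \lambda\prec(\underbrace{1,\dots,1}_{N-1},w_1,w_2,0,\dots,0)\},$$ and equivalently $$\Sigma(w)=\Big\{\lambda\in\mathbb R^d:\ \lambda_i\ge 0\ \text{for all } i,\ \ \sum_{i=1}^d\lambda_i=N,\ \ \lambda^\downarrow_1\le 1,\ \ \sum_{j=1}^N\lambda^\downarrow_j\le N-1+w_1\Big\}.$$ (r = 1) For $w=(1,0,\dots,0)$ (and $d\ge N$), one has $$\Sigma(w)=\{\lambda\in\mathbb R^d:\ \lambda\prec(\underbrace{1,\dots,1}_{N},0,\dots,0)\}=\Big\{\lambda\in\mathbb R^d:\ \lambda_i\ge 0\ \text{for all } i,\ \ \sum_{i=1}^d\lambda_i=N,\ \ \lambda^\downarrow_1\le 1\Big\},$$ i.e. exactly the ordinary Pauli exclusion principle. -/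

import Mathlib

noncomputable section

namespace WRDMFT

/-! ### Operators on finite-dimensional complex Hilbert spaces -/

section Operators

variable {H : Type*} [NormedAddCommGroup H] [InnerProductSpace ℂ H]

/-- `T` is diagonal, with the real eigenvalues `v i`, in some orthonormal basis indexed by `ι`.
Thus `v` lists the spectrum of `T`, each eigenvalue repeated according to its multiplicity,
in an arbitrary order. -/
def HasSpec {ι : Type*} [Fintype ι] (T : H →ₗ[ℂ] H) (v : ι → ℝ) : Prop :=
  ∃ b : OrthonormalBasis ι ℂ H, ∀ i, T (b i) = (v i : ℂ) • b i

/-- Density operators: positive semidefinite (in particular self-adjoint) of trace one. -/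
def IsDensity [FiniteDimensional ℂ H] (T : H →ₗ[ℂ] H) : Prop :=
  T.IsPositive ∧ LinearMap.trace ℂ H T = 1

end Operators

/-! ### `N` fermions with one-particle space `ℂ^d` -/

/-- The one-particle Hilbert space of dimension `d`. -/
abbrev OneParticle (d : ℕ) : Type := EuclideanSpace ℂ (Fin d)

/-- The `N`-fold tensor power of the one-particle space, in coordinates: `Ψ x` is the coefficient
of `e_{x 0} ⊗ ⋯ ⊗ e_{x (N - 1)}`, and these product vectors are orthonormal. -/
abbrev NParticle (N d : ℕ) : Type := EuclideanSpace ℂ (Fin N → Fin d)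

/-- The product basis vector `e_{x 0} ⊗ ⋯ ⊗ e_{x (N - 1)}`. -/
def productVec {N d : ℕ} (x : Fin N → Fin d) : NParticle N d := EuclideanSpace.single x 1

/-- The `N`-fermion Hilbert space: the antisymmetric tensors. -/
def fermionSpace (N d : ℕ) : Submodule ℂ (NParticle N d) where
  carrier := {Ψ | ∀ (σ : Equiv.Perm (Fin N)) (x : Fin N → Fin d),
    Ψ (x ∘ σ) = ((Equiv.Perm.sign σ : ℤ) : ℂ) * Ψ x}
  add_mem' := by
    intro Ψ Φ hΨ hΦ σ x
    have h1 := hΨ σ x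
    have h2 := hΦ σ x
    simp only [PiLp.add_apply, h1, h2, mul_add]
  zero_mem' := by
    intro σ x
    simp
  smul_mem' := by
    intro c Ψ hΨ σ x
    have h1 := hΨ σ x
    simp only [PiLp.smul_apply, smul_eq_mul, h1]
    ring

/-- Operators on the `N`-fermion Hilbert space. -/
abbrev FermionOp (N d : ℕ) : Type := fermionSpace N d →ₗ[ℂ] fermionSpace N d

/-- The dimension `D` of the `N`-fermion Hilbert space. -/
def fermionDim (N d : ℕ) : ℕ := Module.finrank ℂ (fermionSpace N d)

/-- An operator on the `N`-fermion space, seen as an operator on the `N`-fold tensor power that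
vanishes on the orthogonal complement of the antisymmetric tensors. -/
def extendOp {N d : ℕ} (Γ : FermionOp N d) : NParticle N d →ₗ[ℂ] NParticle N d :=
  (fermionSpace N d).subtype ∘ₗ Γ ∘ₗ ((fermionSpace N d).orthogonalProjectionOnto).toLinearMap

/-- The partial trace `Tr_{N-1}` over all particles but the first one:
`⟨e_i, (Tr_{N-1} A) e_j⟩ = ∑_z ⟨e_i ⊗ e_z, A (e_j ⊗ e_z)⟩`, where `z` runs over the states of the
product basis of the other `N - 1` particles. -/
def partialTrace {N d : ℕ} [NeZero N] (A : NParticle N d →ₗ[ℂ] NParticle N d) :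
    OneParticle d →ₗ[ℂ] OneParticle d :=
  Matrix.toEuclideanLin (Matrix.of fun i j : Fin d =>
    ∑ x : Fin N → Fin d with x 0 = i,
      inner ℂ (productVec x) (A (productVec (Function.update x 0 j))))

/-- The one-particle reduced density operator `γ = N Tr_{N-1} Γ`. -/
def oneRDM {N d : ℕ} [NeZero N] (Γ : FermionOp N d) : OneParticle d →ₗ[ℂ] OneParticle d :=
  (N : ℂ) • partialTrace (extendOp Γ)

/-- `𝓔^N(w)`: the `N`-fermion density operators with spectrum `w`. -/
def ensembles (N d : ℕ) (w : Fin (fermionDim N d) → ℝ) : Set (FermionOp N d) :=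
  {Γ | IsDensity (H := fermionSpace N d) Γ ∧ HasSpec (H := fermionSpace N d) Γ w}

/-- `𝓔^1_N(w) = N Tr_{N-1} 𝓔^N(w)`. -/
def oneRDMs (N d : ℕ) [NeZero N] (w : Fin (fermionDim N d) → ℝ) :
    Set (OneParticle d →ₗ[ℂ] OneParticle d) :=
  oneRDM '' ensembles N d w

/-- The spectral polytope `Σ(w)`: all vectors of natural occupation numbers (eigenvalues with
multiplicity, in any order) of the operators in the convex hull of `𝓔^1_N(w)`. -/
def spectralPolytope (N d : ℕ) [NeZero N] (w : Fin (fermionDim N d) → ℝ) : Set (Fin d → ℝ) :=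
  {lam | ∃ γ ∈ convexHull ℝ (oneRDMs N d w), HasSpec (H := OneParticle d) γ lam}

/-- The weight vector `(w₁, w₂, 0, …, 0)` with `D` entries. -/
def twoWeights (D : ℕ) (w₁ w₂ : ℝ) : Fin D → ℝ :=
  fun j => if j.val = 0 then w₁ else if j.val = 1 then w₂ else 0

/-- The vector `(1, …, 1, w₁, w₂, 0, …, 0)` with `d` entries and `N - 1` leading ones. -/
def twoVertex (N d : ℕ) (w₁ w₂ : ℝ) : Fin d → ℝ :=
  fun j => if j.val + 1 < N then 1 else if j.val + 1 = N then w₁ else if j.val = N then w₂ else 0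

/-- The vector `(1, …, 1, 0, …, 0)` with `d` entries and `N` leading ones. -/
def oneVertex (N d : ℕ) : Fin d → ℝ :=
  fun j => if j.val < N then 1 else 0

/-! ### Majorization -/

/-- The decreasing rearrangement `v↓`. -/
def sortDesc {n : ℕ} (v : Fin n → ℝ) : Fin n → ℝ :=
  fun j => v (Tuple.sort (fun i => -v i) j)

/-- The sum of the first `k` entries of `v↓`. -/
def topSum {n : ℕ} (v : Fin n → ℝ) (k : ℕ) : ℝ :=
  ∑ j : Fin n with j.val < k, sortDesc v j

/-- Majorization `v ≺ u` of real vectors of the same length and the same total. -/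
def Majorized {n : ℕ} (v u : Fin n → ℝ) : Prop :=
  (∀ k : ℕ, 1 ≤ k → k ≤ n → topSum v k ≤ topSum u k) ∧ ∑ i, v i = ∑ i, u i

end WRDMFT

end

noncomputable section

namespace WRDMFT

/-! ### Product bases of the `N`-particle space -/

section ProductBasis

variable {d : ℕ}

/-! Each equality follows from a cycle: polytope ⊆ inequalities ⊆ majorized vectors ⊆ polytope.

Necessity: the spectrum of `γ` is its diagonal in an eigenbasis `b`, and the diagonal in a fixed `b`
is linear in `γ`. Convex constraints therefore need checking only on the RDM of a single ensemble,
but for every `b` (`spectralPolytope_subset`). There the diagonal is the `w`-average of occupation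
numbers (`inner_oneRDM`). Antisymmetric coefficients vanish at repeated indices, so each orbital is
occupied at most once: Pauli. For `N` chosen orbitals, every other configuration misses at least one
of them, so their total occupation is at most `N - 1` plus the weight on their Slater determinant
(`sum_occupation_image_le`). Across an orthonormal basis of states those weights add up to at most 1
(`sum_coeffWeight_basis_le`), so their `w`-average is at most the largest `w k`.

Sufficiency: the inequalities bound every partial sum of `lam↓` by that of the vertex vector, and
Rado's theorem makes `lam` a mixture of permuted vertices. A permuted vertex is the diagonal RDM of
one Slater determinant, or of a mixture of two sharing `N - 1` orbitals (`twoVertex_comp_mem`). -/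

/-- The product vector `b (y 0) ⊗ ⋯ ⊗ b (y (N - 1))`. -/
def tensorVec (N : ℕ) (b : OrthonormalBasis (Fin d) ℂ (OneParticle d)) (y : Fin N → Fin d) :
    NParticle N d :=
  WithLp.toLp 2 fun x => ∏ m, b (y m) (x m)

theorem orthonormal_tensorVec (N : ℕ) (b : OrthonormalBasis (Fin d) ℂ (OneParticle d)) :
    Orthonormal ℂ (tensorVec N b) := by
  rw [orthonormal_iff_ite]
  intro y y'
  have h1 : inner ℂ (tensorVec N b y) (tensorVec N b y') =
      ∑ x : Fin N → Fin d, ∏ m, (b (y' m) (x m) * starRingEnd ℂ (b (y m) (x m))) := by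
    simp [tensorVec, PiLp.inner_apply, Finset.prod_mul_distrib, map_prod]
  have h2 : ∀ m, ∑ a, (b (y' m) a * starRingEnd ℂ (b (y m) a)) = if y m = y' m then 1 else 0 := by
    intro m
    have := orthonormal_iff_ite.1 b.orthonormal (y m) (y' m)
    rw [← this]
    simp [PiLp.inner_apply]
  rw [h1, ← Fintype.prod_sum (fun m a => b (y' m) a * starRingEnd ℂ (b (y m) a))]
  simp only [h2]
  rw [Finset.prod_ite_zero]
  simp [funext_iff]

/-- The orthonormal basis of product vectors. -/
def tensorBasis (N : ℕ) (b : OrthonormalBasis (Fin d) ℂ (OneParticle d)) :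
    OrthonormalBasis (Fin N → Fin d) ℂ (NParticle N d) :=
  -- The family already has full cardinality, so extending it from `Set.univ` changes no vector.
  (Classical.choose (Orthonormal.exists_orthonormalBasis_extension_of_card_eq
    (ι := Fin N → Fin d) (𝕜 := ℂ) (E := NParticle N d) (by simp) (v := tensorVec N b)
    (s := Set.univ) ((orthonormal_tensorVec N b).comp _ Subtype.val_injective)))

theorem tensorBasis_apply (N : ℕ) (b : OrthonormalBasis (Fin d) ℂ (OneParticle d))
    (y : Fin N → Fin d) : tensorBasis N b y = tensorVec N b y :=
  Classical.choose_spec (Orthonormal.exists_orthonormalBasis_extension_of_card_eq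
    (ι := Fin N → Fin d) (𝕜 := ℂ) (E := NParticle N d) (by simp) (v := tensorVec N b)
    (s := Set.univ) ((orthonormal_tensorVec N b).comp _ Subtype.val_injective)) y (Set.mem_univ y)

theorem inner_tensorVec (N : ℕ) (b : OrthonormalBasis (Fin d) ℂ (OneParticle d))
    (y : Fin N → Fin d) (Ψ : NParticle N d) :
    inner ℂ (tensorVec N b y) Ψ = ∑ x, Ψ x * ∏ m, starRingEnd ℂ (b (y m) (x m)) := by
  simp [tensorVec, PiLp.inner_apply, map_prod]

theorem sum_sq_inner_tensorVec (N : ℕ) (b : OrthonormalBasis (Fin d) ℂ (OneParticle d))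
    (Ψ : NParticle N d) : ∑ y, ‖inner ℂ (tensorVec N b y) Ψ‖ ^ 2 = ‖Ψ‖ ^ 2 := by
  rw [← (tensorBasis N b).sum_sq_norm_inner_right Ψ]
  simp only [tensorBasis_apply]

/-- Antisymmetry does not depend on the orbital basis, so the counting arguments below apply in an
eigenbasis of `γ`. -/
theorem inner_tensorVec_comp {N : ℕ} (b : OrthonormalBasis (Fin d) ℂ (OneParticle d))
    {Ψ : NParticle N d} (hΨ : Ψ ∈ fermionSpace N d) (σ : Equiv.Perm (Fin N)) (y : Fin N → Fin d) :
    inner ℂ (tensorVec N b (y ∘ σ)) Ψ =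
      ((Equiv.Perm.sign σ : ℤ) : ℂ) * inner ℂ (tensorVec N b y) Ψ := by
  rw [inner_tensorVec, inner_tensorVec, Finset.mul_sum,
    ← Equiv.sum_comp (Equiv.arrowCongr σ.symm (Equiv.refl (Fin d)))]
  refine Finset.sum_congr rfl fun x _ => ?_
  have h : (Equiv.arrowCongr σ.symm (Equiv.refl (Fin d))) x = x ∘ σ := by
    ext; simp [Equiv.arrowCongr]
  rw [h, hΨ σ x, ← Equiv.prod_comp σ fun m => starRingEnd ℂ (b (y m) (x m))]
  simp only [Function.comp_apply]
  ring

theorem sum_filter_zero_eq {M : Type*} [AddCommMonoid M] {n : ℕ} (a : Fin d)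
    (g : (Fin (n + 1) → Fin d) → M) :
    ∑ x : Fin (n + 1) → Fin d with x 0 = a, g x = ∑ z : Fin n → Fin d, g (Fin.cons a z) := by
  symm
  refine Finset.sum_bij (fun z _ => Fin.cons a z) ?_ ?_ ?_ ?_
  · simp
  · intro z _ z' _ h
    simpa using congrArg Fin.tail h
  · intro x hx
    refine ⟨Fin.tail x, Finset.mem_univ _, ?_⟩
    have h0 : x 0 = a := by simpa using hx
    rw [← h0, Fin.cons_self_tail]
  · simp

/-- Diagonal entries of the partial trace of `|Ψ⟩⟨Ψ|` in the basis `b`. -/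
theorem sum_partialTrace_eq {N : ℕ} [NeZero N] (b : OrthonormalBasis (Fin d) ℂ (OneParticle d))
    (Ψ : NParticle N d) (i : Fin d) :
    ∑ a, ∑ a', starRingEnd ℂ (b i a) * b i a' *
        ∑ x : Fin N → Fin d with x 0 = a, Ψ x * starRingEnd ℂ (Ψ (Function.update x 0 a')) =
      ((∑ y : Fin N → Fin d with y 0 = i, ‖inner ℂ (tensorVec N b y) Ψ‖ ^ 2 : ℝ) : ℂ) := by
  obtain ⟨n, rfl⟩ : ∃ n, N = n + 1 := Nat.exists_eq_succ_of_ne_zero (NeZero.ne N)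
  -- `φ` contracts the first slot of `Ψ` with `b i`; both sides equal `‖φ‖ ^ 2`, the right one by
  -- Parseval for `n` particles.
  let φ : NParticle n d := WithLp.toLp 2 fun z => ∑ a, starRingEnd ℂ (b i a) * Ψ (Fin.cons a z)
  have h1 : ∀ z : Fin n → Fin d,
      inner ℂ (tensorVec (n + 1) b (Fin.cons i z)) Ψ = inner ℂ (tensorVec n b z) φ := by
    intro z
    have h := Finset.sum_fiberwise Finset.univ (fun x : Fin (n + 1) → Fin d => x 0)
      fun x => Ψ x * ∏ m, starRingEnd ℂ (b ((Fin.cons i z : Fin (n + 1) → Fin d) m) (x m))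
    rw [inner_tensorVec, inner_tensorVec, ← h]
    simp only [sum_filter_zero_eq, Fin.prod_univ_succ, Fin.cons_zero, Fin.cons_succ, φ]
    rw [Finset.sum_comm]
    refine Finset.sum_congr rfl fun x _ => ?_
    rw [Finset.sum_mul]
    exact Finset.sum_congr rfl fun a _ => by ring
  rw [sum_filter_zero_eq]
  simp only [h1, sum_sq_inner_tensorVec, sum_filter_zero_eq, Fin.update_cons_zero]
  rw [EuclideanSpace.norm_sq_eq]
  simp only [Complex.ofReal_sum, Complex.ofReal_pow, ← Complex.mul_conj']
  have h2 : ∀ z, φ z * starRingEnd ℂ (φ z) = ∑ a, ∑ a',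
      starRingEnd ℂ (b i a) * b i a' *
        (Ψ (Fin.cons a z) * starRingEnd ℂ (Ψ (Fin.cons a' z))) := by
    intro z
    simp only [φ, map_sum, Finset.sum_mul_sum, map_mul, Complex.conj_conj]
    exact Finset.sum_congr rfl fun a _ => Finset.sum_congr rfl fun a' _ => by ring
  simp only [h2, Finset.mul_sum]
  rw [Finset.sum_comm (s := (Finset.univ : Finset (Fin n → Fin d)))]
  exact Finset.sum_congr rfl fun a _ => Finset.sum_comm

end ProductBasis

/-! ### Occupation numbers of antisymmetric weights -/

section Occupation

variable {N d : ℕ} {q : (Fin N → Fin d) → ℝ}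

/-- By symmetry all `N` slots contribute equally, and an injective `y` containing `i` holds it in
exactly one slot. This absorbs the factor `N` of the RDM. -/
theorem mul_sum_filter_zero [NeZero N] (hq : ∀ (σ : Equiv.Perm (Fin N)) y, q (y ∘ σ) = q y)
    (hinj : ∀ y, q y ≠ 0 → Function.Injective y) (i : Fin d) :
    (N : ℝ) * ∑ y : Fin N → Fin d with y 0 = i, q y =
      ∑ y : Fin N → Fin d with i ∈ Finset.univ.image y, q y := by
  have h1 : ∀ k : Fin N, ∑ y : Fin N → Fin d with y k = i, q y =
      ∑ y : Fin N → Fin d with y 0 = i, q y := by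
    intro k
    refine Finset.sum_bij (fun y _ => y ∘ Equiv.swap 0 k) ?_ ?_ ?_ ?_
    · simp
    · intro y _ y' _ h
      exact (Equiv.swap 0 k).surjective.injective_comp_right h
    · intro y hy
      refine ⟨y ∘ Equiv.swap 0 k, by simpa using hy, ?_⟩
      ext m; simp
    · intro y _
      exact (hq _ _).symm
  have h2 : (N : ℝ) * ∑ y : Fin N → Fin d with y 0 = i, q y =
      ∑ k : Fin N, ∑ y : Fin N → Fin d with y k = i, q y := by
    simp [h1]
  rw [h2]
  simp only [Finset.sum_filter]
  rw [Finset.sum_comm]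
  refine Finset.sum_congr rfl fun y _ => ?_
  by_cases hy : q y = 0
  · simp [hy]
  split_ifs with h
  · obtain ⟨k, -, rfl⟩ := Finset.mem_image.1 h
    simp [(hinj y hy).eq_iff]
  · refine Finset.sum_eq_zero fun k _ => if_neg fun hk => h ?_
    exact Finset.mem_image.2 ⟨k, Finset.mem_univ _, hk⟩

theorem sum_occupation (A : Finset (Fin d)) :
    ∑ i ∈ A, ∑ y : Fin N → Fin d with i ∈ Finset.univ.image y, q y =
      ∑ y : Fin N → Fin d, ((A ∩ Finset.univ.image y).card : ℝ) * q y := by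
  simp only [Finset.sum_filter]
  rw [Finset.sum_comm]
  refine Finset.sum_congr rfl fun y _ => ?_
  rw [← Finset.sum_filter, Finset.sum_const, nsmul_eq_mul, Finset.filter_mem_eq_inter]

theorem sum_occupation_univ (hinj : ∀ y, q y ≠ 0 → Function.Injective y) :
    ∑ i, ∑ y : Fin N → Fin d with i ∈ Finset.univ.image y, q y = N * ∑ y, q y := by
  rw [sum_occupation, Finset.mul_sum]
  refine Finset.sum_congr rfl fun y _ => ?_
  by_cases hy : q y = 0
  · simp [hy]
  rw [Finset.univ_inter, Finset.card_image_of_injective _ (hinj y hy)]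
  simp

theorem sum_image_perm (hq : ∀ (σ : Equiv.Perm (Fin N)) y, q (y ∘ σ) = q y)
    {f : Fin N → Fin d} (hf : Function.Injective f) :
    ∑ y ∈ Finset.univ.image (fun σ : Equiv.Perm (Fin N) => f ∘ σ), q y = N.factorial * q f := by
  rw [Finset.sum_image]
  · simp [hq, Fintype.card_perm]
  · intro σ _ τ _ h
    exact Equiv.coe_fn_injective (hf.comp_left h)

theorem factorial_mul_le (hq : ∀ (σ : Equiv.Perm (Fin N)) y, q (y ∘ σ) = q y)
    (hq0 : ∀ y, 0 ≤ q y) {f : Fin N → Fin d} (hf : Function.Injective f) :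
    N.factorial * q f ≤ ∑ y, q y := by
  rw [← sum_image_perm hq hf]
  exact Finset.sum_le_sum_of_subset_of_nonneg (Finset.subset_univ _) fun y _ _ => hq0 y

theorem exists_perm_of_image_eq {f y : Fin N → Fin d}
    (hy : Function.Injective y) (h : ∀ m, y m ∈ Set.range f) :
    ∃ σ : Equiv.Perm (Fin N), y = f ∘ σ := by
  choose s hs using h
  have hsi : Function.Injective s := fun a c hac => hy (by rw [← hs a, ← hs c, hac])
  exact ⟨Equiv.ofBijective s (Finite.injective_iff_bijective.1 hsi), funext fun m => (hs m).symm⟩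

/-- A configuration of nonzero weight meets the `N` orbitals of `f` in at most `N - 1` places unless
it is one of the `N!` rearrangements of `f`, all of weight `q f`. -/
theorem sum_occupation_image_le (hq : ∀ (σ : Equiv.Perm (Fin N)) y, q (y ∘ σ) = q y)
    (hq0 : ∀ y, 0 ≤ q y) (hinj : ∀ y, q y ≠ 0 → Function.Injective y)
    {f : Fin N → Fin d} (hf : Function.Injective f) :
    ∑ i ∈ Finset.univ.image f, ∑ y : Fin N → Fin d with i ∈ Finset.univ.image y, q y ≤
      ((N : ℝ) - 1) * ∑ y, q y + N.factorial * q f := by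
  classical
  rw [sum_occupation, ← sum_image_perm hq hf, Finset.mul_sum]
  have hR : ∑ y ∈ Finset.univ.image (fun σ : Equiv.Perm (Fin N) => f ∘ σ), q y =
      ∑ y, if y ∈ Finset.univ.image (fun σ : Equiv.Perm (Fin N) => f ∘ σ) then q y else 0 := by
    simp [← Finset.sum_filter]
  rw [hR, ← Finset.sum_add_distrib]
  refine Finset.sum_le_sum fun y _ => ?_
  by_cases hy : q y = 0
  · simp [hy]
  have hcard : (Finset.univ.image y).card = N := by
    rw [Finset.card_image_of_injective _ (hinj y hy)]; simp
  have hle : (Finset.univ.image f ∩ Finset.univ.image y).card ≤ N :=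
    (Finset.card_le_card Finset.inter_subset_right).trans hcard.le
  split_ifs with h
  · have : ((Finset.univ.image f ∩ Finset.univ.image y).card : ℝ) ≤ N := by exact_mod_cast hle
    nlinarith [hq0 y, mul_le_mul_of_nonneg_right this (hq0 y)]
  · have hlt : (Finset.univ.image f ∩ Finset.univ.image y).card < N := by
      refine lt_of_le_of_ne hle fun heq => h ?_
      have hsub := Finset.eq_of_subset_of_card_le
        (Finset.inter_subset_right (s₁ := Finset.univ.image f) (s₂ := Finset.univ.image y))
        (by rw [hcard, heq])
      obtain ⟨σ, hσ⟩ := exists_perm_of_image_eq (f := f) (hinj y hy) fun m => by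
        have : y m ∈ Finset.univ.image f ∩ Finset.univ.image y := by
          rw [hsub]; exact Finset.mem_image_of_mem _ (Finset.mem_univ _)
        simpa using (Finset.mem_inter.1 this).1
      exact Finset.mem_image.2 ⟨σ, Finset.mem_univ _, hσ.symm⟩
    have h3 : ((Finset.univ.image f ∩ Finset.univ.image y).card : ℝ) + 1 ≤ N := by
      exact_mod_cast hlt
    have := mul_le_mul_of_nonneg_right (le_sub_iff_add_le.2 h3) (hq0 y)
    linarith

/-- Antisymmetric coefficients vanish at repeated indices. -/
theorem injective_of_antisymm {c : (Fin N → Fin d) → ℂ}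
    (hc : ∀ (σ : Equiv.Perm (Fin N)) y, c (y ∘ σ) = ((Equiv.Perm.sign σ : ℤ) : ℂ) * c y)
    {y : Fin N → Fin d} (hy : c y ≠ 0) : Function.Injective y := by
  intro a e hae
  by_contra hne
  have h1 := hc (Equiv.swap a e) y
  have h2 : y ∘ Equiv.swap a e = y := by
    ext m
    by_cases hma : m = a
    · simp [hma, hae]
    by_cases hme : m = e
    · simp [hme, hae]
    simp [Equiv.swap_apply_of_ne_of_ne hma hme]
  rw [h2, Equiv.Perm.sign_swap hne] at h1
  simp only [Units.val_neg, Units.val_one, Int.cast_neg, Int.cast_one, neg_mul, one_mul] at h1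
  exact hy (self_eq_neg.1 h1)

theorem norm_sq_comp_perm {c : (Fin N → Fin d) → ℂ}
    (hc : ∀ (σ : Equiv.Perm (Fin N)) y, c (y ∘ σ) = ((Equiv.Perm.sign σ : ℤ) : ℂ) * c y)
    (σ : Equiv.Perm (Fin N)) (y : Fin N → Fin d) : ‖c (y ∘ σ)‖ ^ 2 = ‖c y‖ ^ 2 := by
  rw [hc, norm_mul]
  rcases Int.units_eq_one_or (Equiv.Perm.sign σ) with h | h <;> simp [h]

end Occupation

/-! ### Reduced density operators in coordinates -/

section Reduced

variable {N d : ℕ}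

theorem HasSpec.apply_eq_sum {H : Type*} [NormedAddCommGroup H] [InnerProductSpace ℂ H]
    {ι : Type*} [Fintype ι] {T : H →ₗ[ℂ] H} {v : ι → ℝ} {B : OrthonormalBasis ι ℂ H}
    (hB : ∀ i, T (B i) = (v i : ℂ) • B i) (u : H) :
    T u = ∑ k, ((v k : ℂ) * inner ℂ (B k) u) • B k := by
  conv_lhs => rw [← B.sum_repr' u]
  rw [map_sum]
  refine Finset.sum_congr rfl fun k _ => ?_
  rw [map_smul, hB, smul_smul, mul_comm]

theorem inner_productVec (x : Fin N → Fin d) (Ψ : NParticle N d) :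
    inner ℂ (productVec x) Ψ = Ψ x := by
  simp [productVec, EuclideanSpace.inner_single_left]

theorem inner_productVec_extendOp {ι : Type*} [Fintype ι] {Γ : FermionOp N d} {w : ι → ℝ}
    {B : OrthonormalBasis ι ℂ (fermionSpace N d)} (hB : ∀ k, Γ (B k) = (w k : ℂ) • B k)
    (x x' : Fin N → Fin d) :
    inner ℂ (productVec x) (extendOp Γ (productVec x')) =
      ∑ k, (w k : ℂ) * ((B k : NParticle N d) x *
        starRingEnd ℂ ((B k : NParticle N d) x')) := by
  have h : ∀ k, inner ℂ (B k) ((fermionSpace N d).orthogonalProjectionOnto (productVec x')) =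
      starRingEnd ℂ ((B k : NParticle N d) x') := by
    intro k
    rw [Submodule.inner_orthogonalProjectionOnto_eq_of_mem_left, ← inner_conj_symm,
      inner_productVec]
  rw [inner_productVec]
  simp only [extendOp, LinearMap.comp_apply, ContinuousLinearMap.coe_coe, Submodule.subtype_apply]
  have hΓ : Γ ((fermionSpace N d).orthogonalProjectionOnto (productVec x')) = _ :=
    HasSpec.apply_eq_sum (H := fermionSpace N d) hB _
  rw [hΓ]
  simp only [h, Submodule.coe_sum, Submodule.coe_smul, WithLp.ofLp_sum, WithLp.ofLp_smul,
    Finset.sum_apply, Pi.smul_apply, smul_eq_mul]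
  exact Finset.sum_congr rfl fun k _ => by ring

/-- Matrix entries of the one-particle reduced density operator. -/
def rdmEntry {ι : Type*} [Fintype ι] [NeZero N] (w : ι → ℝ) (B : ι → NParticle N d)
    (a a' : Fin d) : ℂ :=
  (N : ℂ) * ∑ k, (w k : ℂ) * ∑ x : Fin N → Fin d with x 0 = a,
    B k x * starRingEnd ℂ (B k (Function.update x 0 a'))

theorem oneRDM_eq [NeZero N] {ι : Type*} [Fintype ι] {Γ : FermionOp N d} {w : ι → ℝ}
    {B : OrthonormalBasis ι ℂ (fermionSpace N d)} (hB : ∀ k, Γ (B k) = (w k : ℂ) • B k) :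
    oneRDM Γ = Matrix.toEuclideanLin (Matrix.of (rdmEntry w fun k => (B k : NParticle N d))) := by
  rw [oneRDM, partialTrace, ← map_smul]
  congr 1
  ext a a'
  simp only [Matrix.smul_apply, Matrix.of_apply, rdmEntry, inner_productVec_extendOp hB,
    smul_eq_mul]
  rw [Finset.sum_comm]
  simp only [Finset.mul_sum]

theorem inner_toEuclideanLin (M : Matrix (Fin d) (Fin d) ℂ) (u : OneParticle d) :
    inner ℂ u (Matrix.toEuclideanLin M u) =
      ∑ a, ∑ a', starRingEnd ℂ (u a) * u a' * M a a' := by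
  simp only [PiLp.inner_apply, RCLike.inner_apply, Matrix.toLpLin_apply, Matrix.mulVec,
    dotProduct, Finset.sum_mul]
  exact Finset.sum_congr rfl fun a _ => Finset.sum_congr rfl fun a' _ => by ring

/-- The coefficient weights `|⟨b_{y 0} ⊗ ⋯ ⊗ b_{y (N - 1)}, Ψ⟩|²`. -/
def coeffWeight (b : OrthonormalBasis (Fin d) ℂ (OneParticle d)) (Ψ : NParticle N d)
    (y : Fin N → Fin d) : ℝ :=
  ‖inner ℂ (tensorVec N b y) Ψ‖ ^ 2

/-- The occupation number of the orbital `b i` in the state `Ψ`. -/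
def occupation (b : OrthonormalBasis (Fin d) ℂ (OneParticle d)) (Ψ : NParticle N d)
    (i : Fin d) : ℝ :=
  ∑ y : Fin N → Fin d with i ∈ Finset.univ.image y, coeffWeight b Ψ y

variable (b : OrthonormalBasis (Fin d) ℂ (OneParticle d))

theorem coeffWeight_nonneg (Ψ : NParticle N d) (y : Fin N → Fin d) : 0 ≤ coeffWeight b Ψ y :=
  sq_nonneg _

theorem coeffWeight_comp (Ψ : fermionSpace N d) (σ : Equiv.Perm (Fin N)) (y : Fin N → Fin d) :
    coeffWeight b (Ψ : NParticle N d) (y ∘ σ) = coeffWeight b (Ψ : NParticle N d) y :=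
  norm_sq_comp_perm (c := fun y => inner ℂ (tensorVec N b y) (Ψ : NParticle N d))
    (inner_tensorVec_comp b Ψ.2) σ y

theorem injective_of_coeffWeight_ne_zero (Ψ : fermionSpace N d) (y : Fin N → Fin d)
    (hy : coeffWeight b (Ψ : NParticle N d) y ≠ 0) : Function.Injective y :=
  injective_of_antisymm (c := fun y => inner ℂ (tensorVec N b y) (Ψ : NParticle N d))
    (inner_tensorVec_comp b Ψ.2) fun h => hy (by
      simp [coeffWeight, h])

theorem sum_coeffWeight (Ψ : NParticle N d) : ∑ y, coeffWeight b Ψ y = ‖Ψ‖ ^ 2 :=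
  sum_sq_inner_tensorVec N b Ψ

theorem occupation_nonneg (Ψ : NParticle N d) (i : Fin d) : 0 ≤ occupation b Ψ i :=
  Finset.sum_nonneg fun y _ => coeffWeight_nonneg b Ψ y

theorem occupation_le (Ψ : NParticle N d) (i : Fin d) : occupation b Ψ i ≤ ‖Ψ‖ ^ 2 := by
  rw [← sum_coeffWeight b]
  exact Finset.sum_le_sum_of_subset_of_nonneg (Finset.subset_univ _)
    fun y _ _ => coeffWeight_nonneg b Ψ y

/-- Diagonal entries of the reduced density operator are averaged occupation numbers. -/
theorem inner_oneRDM [NeZero N] {ι : Type*} [Fintype ι] {Γ : FermionOp N d} {w : ι → ℝ}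
    {B : OrthonormalBasis ι ℂ (fermionSpace N d)} (hB : ∀ k, Γ (B k) = (w k : ℂ) • B k)
    (i : Fin d) :
    inner ℂ (b i) (oneRDM Γ (b i)) =
      ((∑ k, w k * occupation b (B k : NParticle N d) i : ℝ) : ℂ) := by
  have h1 : ∀ k, occupation b (B k : NParticle N d) i =
      N * ∑ y : Fin N → Fin d with y 0 = i, coeffWeight b (B k : NParticle N d) y := fun k =>
    (mul_sum_filter_zero (coeffWeight_comp b (B k))
      (injective_of_coeffWeight_ne_zero b (B k)) i).symm
  rw [oneRDM_eq hB, inner_toEuclideanLin]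
  simp only [h1, coeffWeight, Complex.ofReal_sum, Complex.ofReal_mul, Complex.ofReal_natCast]
  simp only [← Complex.ofReal_sum, ← sum_partialTrace_eq b, Matrix.of_apply, rdmEntry,
    Finset.mul_sum (s := (Finset.univ : Finset ι))]
  conv_lhs =>
    enter [2, a]
    rw [Finset.sum_comm]
  rw [Finset.sum_comm]
  simp only [Finset.mul_sum (s := (Finset.univ : Finset (Fin d)))]
  refine Finset.sum_congr rfl fun k _ => Finset.sum_congr rfl fun a _ =>
    Finset.sum_congr rfl fun a' _ => by ring

/-- The total weight of an orthonormal family of fermionic states on one Slater determinant. -/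
theorem sum_coeffWeight_basis_le {ι : Type*} [Fintype ι]
    (B : OrthonormalBasis ι ℂ (fermionSpace N d)) {f : Fin N → Fin d}
    (hf : Function.Injective f) :
    N.factorial * ∑ k, coeffWeight b (B k : NParticle N d) f ≤ 1 := by
  -- By Parseval the sum over `k` is `‖p‖ ^ 2`, which is also the coefficient of `p` itself at `f`.
  -- Hence `factorial_mul_le` for `p` reads `N! * ‖p‖ ^ 4 ≤ ‖p‖ ^ 2`; divide unless `p = 0`.
  let p : fermionSpace N d := (fermionSpace N d).orthogonalProjectionOnto (tensorVec N b f)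
  have h1 : ∀ Ψ : fermionSpace N d,
      inner ℂ (tensorVec N b f) (Ψ : NParticle N d) = inner ℂ p Ψ := fun Ψ => by
    rw [Submodule.inner_orthogonalProjectionOnto_eq_of_mem_right]
  have h2 : ∑ k, coeffWeight b (B k : NParticle N d) f = ‖p‖ ^ 2 := by
    simp only [coeffWeight, h1]
    exact B.sum_sq_norm_inner_left p
  have h3 := factorial_mul_le (coeffWeight_comp b p)
    (coeffWeight_nonneg b (p : NParticle N d)) hf
  have hp := inner_self_eq_norm_sq_to_K (𝕜 := ℂ) p
  rw [sum_coeffWeight, coeffWeight, h1, hp, Submodule.coe_norm] at h3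
  have h4 : (N.factorial : ℝ) * (‖p‖ ^ 2) ^ 2 ≤ ‖p‖ ^ 2 := by simpa using h3
  rw [h2]
  rcases (sq_nonneg ‖p‖).eq_or_lt with h0 | h0
  · rw [← h0]; norm_num
  · have : (N.factorial : ℝ) * ‖p‖ ^ 2 * ‖p‖ ^ 2 ≤ 1 * ‖p‖ ^ 2 := by nlinarith
    exact le_of_mul_le_mul_right this h0

end Reduced

/-! ### Necessary conditions on natural occupation numbers -/

section Necessary

variable {N d : ℕ}

/-- Pauli's exclusion principle together with normalization. -/
def pauliPolytope (N d : ℕ) : Set (Fin d → ℝ) :=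
  {lam | (∀ i, 0 ≤ lam i ∧ lam i ≤ 1) ∧ ∑ i, lam i = N}

/-- The occupation vectors for which any `N` orbitals carry weight at most `c`. -/
def slaterBound (N d : ℕ) (c : ℝ) : Set (Fin d → ℝ) :=
  {lam | ∀ f : Fin N → Fin d, Function.Injective f → ∑ m, lam (f m) ≤ c}

theorem convex_pauliPolytope (N d : ℕ) : Convex ℝ (pauliPolytope N d) := by
  rintro x ⟨hx, hxs⟩ y ⟨hy, hys⟩ s t hs ht hst
  refine ⟨fun i => ⟨?_, ?_⟩, ?_⟩
  · simpa using add_nonneg (mul_nonneg hs (hx i).1) (mul_nonneg ht (hy i).1)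
  · have h1 := mul_le_mul_of_nonneg_left (hx i).2 hs
    have h2 := mul_le_mul_of_nonneg_left (hy i).2 ht
    simp only [Pi.add_apply, Pi.smul_apply, smul_eq_mul]
    linarith
  · simp only [Pi.add_apply, Pi.smul_apply, smul_eq_mul, Finset.sum_add_distrib,
      ← Finset.mul_sum, hxs, hys, ← add_mul, hst, one_mul]

theorem convex_slaterBound (N d : ℕ) (c : ℝ) : Convex ℝ (slaterBound N d c) := by
  intro x hx y hy s t hs ht hst f hf
  have h1 := mul_le_mul_of_nonneg_left (hx f hf) hs
  have h2 := mul_le_mul_of_nonneg_left (hy f hf) ht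
  have h3 : s * c + t * c = c := by rw [← add_mul, hst, one_mul]
  simp only [Pi.add_apply, Pi.smul_apply, smul_eq_mul, Finset.sum_add_distrib, ← Finset.mul_sum]
  linarith

/-- The diagonal of an operator in an orthonormal basis. -/
def diagVal (b : OrthonormalBasis (Fin d) ℂ (OneParticle d)) :
    (OneParticle d →ₗ[ℂ] OneParticle d) →ₗ[ℝ] (Fin d → ℝ) where
  toFun T i := (inner ℂ (b i) (T (b i))).re
  map_add' T S := by
    ext i
    simp
  map_smul' c T := by
    ext i
    simp [inner_smul_right_eq_smul]

theorem sum_eq_one_of_isDensity {w : Fin (fermionDim N d) → ℝ} {Γ : FermionOp N d}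
    (hΓ : Γ ∈ ensembles N d w) : ∑ k, w k = 1 := by
  obtain ⟨⟨-, htr⟩, B, hB⟩ := hΓ
  have h := LinearMap.trace_eq_sum_inner Γ B
  have h2 : ∀ k, inner ℂ (B k) (Γ (B k)) = (w k : ℂ) := fun k => by
    rw [hB k, inner_smul_right, orthonormal_iff_ite.1 B.orthonormal, if_pos rfl, mul_one]
  simp only [h2] at h
  have h3 : ((∑ k, w k : ℝ) : ℂ) = 1 := by
    rw [Complex.ofReal_sum, ← h]; exact htr
  exact_mod_cast h3

theorem diagVal_oneRDM [NeZero N] (b : OrthonormalBasis (Fin d) ℂ (OneParticle d))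
    {ι : Type*} [Fintype ι] {Γ : FermionOp N d} {w : ι → ℝ}
    {B : OrthonormalBasis ι ℂ (fermionSpace N d)} (hB : ∀ k, Γ (B k) = (w k : ℂ) • B k) :
    diagVal b (oneRDM Γ) = fun i => ∑ k, w k * occupation b (B k : NParticle N d) i := by
  ext i
  change (inner ℂ (b i) (oneRDM Γ (b i))).re = _
  rw [inner_oneRDM b hB, Complex.ofReal_re]

theorem diagVal_mem_pauliPolytope [NeZero N] (b : OrthonormalBasis (Fin d) ℂ (OneParticle d))
    {w : Fin (fermionDim N d) → ℝ} (hw : ∀ k, 0 ≤ w k) {Γ : FermionOp N d}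
    (hΓ : Γ ∈ ensembles N d w) : diagVal b (oneRDM Γ) ∈ pauliPolytope N d := by
  have hsum := sum_eq_one_of_isDensity hΓ
  obtain ⟨-, B, hB⟩ := hΓ
  have hnorm : ∀ k, ‖(B k : NParticle N d)‖ ^ 2 = 1 := fun k => by
    rw [← Submodule.coe_norm, B.norm_eq_one, one_pow]
  rw [diagVal_oneRDM b hB]
  refine ⟨fun i => ⟨?_, ?_⟩, ?_⟩
  · exact Finset.sum_nonneg fun k _ => mul_nonneg (hw k) (occupation_nonneg b _ i)
  · rw [← hsum]
    refine Finset.sum_le_sum fun k _ => mul_le_of_le_one_right (hw k) ?_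
    rw [← hnorm k]
    exact occupation_le b _ i
  · rw [Finset.sum_comm]
    have : ∀ k, ∑ i, occupation b (B k : NParticle N d) i = N := fun k => by
      have := sum_occupation_univ (injective_of_coeffWeight_ne_zero b (B k))
      rw [sum_coeffWeight, hnorm, mul_one] at this
      exact this
    simp only [← Finset.mul_sum, this, ← Finset.sum_mul, hsum, one_mul]

theorem diagVal_mem_slaterBound [NeZero N] (b : OrthonormalBasis (Fin d) ℂ (OneParticle d))
    {w : Fin (fermionDim N d) → ℝ} (hw : ∀ k, 0 ≤ w k) {c : ℝ} (hc0 : 0 ≤ c)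
    (hc : ∀ k, w k ≤ c) {Γ : FermionOp N d}
    (hΓ : Γ ∈ ensembles N d w) :
    diagVal b (oneRDM Γ) ∈ slaterBound N d ((N : ℝ) - 1 + c) := by
  have hsum := sum_eq_one_of_isDensity hΓ
  obtain ⟨-, B, hB⟩ := hΓ
  have hnorm : ∀ k, ‖(B k : NParticle N d)‖ ^ 2 = 1 := fun k => by
    rw [← Submodule.coe_norm, B.norm_eq_one, one_pow]
  rw [diagVal_oneRDM b hB]
  intro f hf
  have h1 : ∀ k, ∑ m, occupation b (B k : NParticle N d) (f m) ≤
      ((N : ℝ) - 1) + N.factorial * coeffWeight b (B k : NParticle N d) f := fun k => by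
    have := sum_occupation_image_le (coeffWeight_comp b (B k)) (coeffWeight_nonneg b _)
      (injective_of_coeffWeight_ne_zero b (B k)) hf
    rw [sum_coeffWeight, hnorm, mul_one, Finset.sum_image fun _ _ _ _ h => hf h] at this
    exact this
  rw [Finset.sum_comm]
  simp only [← Finset.mul_sum]
  -- Only the determinant term uses `w k ≤ c`; the `N - 1` term keeps `w k`, whose sum is 1.
  calc ∑ k, w k * ∑ m, occupation b (B k : NParticle N d) (f m)
      ≤ ∑ k, (w k * ((N : ℝ) - 1) +
          c * (N.factorial * coeffWeight b (B k : NParticle N d) f)) := by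
        refine Finset.sum_le_sum fun k _ => ?_
        refine (mul_le_mul_of_nonneg_left (h1 k) (hw k)).trans ?_
        rw [mul_add]
        gcongr
        · exact mul_nonneg (Nat.cast_nonneg _) (coeffWeight_nonneg b _ _)
        · exact hc k
    _ = ((N : ℝ) - 1) + c * (N.factorial * ∑ k, coeffWeight b (B k : NParticle N d) f) := by
        rw [Finset.sum_add_distrib, ← Finset.sum_mul, hsum, one_mul, ← Finset.mul_sum,
          ← Finset.mul_sum]
    _ ≤ ((N : ℝ) - 1) + c * 1 := by
        gcongr
        exact sum_coeffWeight_basis_le b B hf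
    _ = (N : ℝ) - 1 + c := by rw [mul_one]

theorem spectralPolytope_subset [NeZero N] {w : Fin (fermionDim N d) → ℝ} {K : Set (Fin d → ℝ)}
    (hK : Convex ℝ K) (h : ∀ (b : OrthonormalBasis (Fin d) ℂ (OneParticle d)),
      ∀ Γ ∈ ensembles N d w, diagVal b (oneRDM Γ) ∈ K) :
    spectralPolytope N d w ⊆ K := by
  rintro lam ⟨γ, hγ, b, hb⟩
  have h1 : convexHull ℝ (oneRDMs N d w) ⊆ diagVal b ⁻¹' K := by
    refine convexHull_min ?_ (hK.linear_preimage (diagVal b))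
    rintro _ ⟨Γ, hΓ, rfl⟩
    exact h b Γ hΓ
  have h2 : diagVal b γ = lam := by
    ext i
    change (inner ℂ (b i) (γ (b i))).re = _
    rw [hb i, inner_smul_right, orthonormal_iff_ite.1 b.orthonormal, if_pos rfl, mul_one,
      Complex.ofReal_re]
  rw [← h2]
  exact h1 hγ

end Necessary

/-! ### Majorization -/

section Majorization

variable {d : ℕ}

theorem antitone_sortDesc (v : Fin d → ℝ) : Antitone (sortDesc v) := by
  intro i j hij
  have := Tuple.monotone_sort (fun i => -v i) hij
  simpa [sortDesc] using this

theorem sortDesc_eq_of_antitone {v : Fin d → ℝ} (hv : Antitone v) : sortDesc v = v := by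
  have h : Tuple.sort (fun i => -v i) = Equiv.refl (Fin d) :=
    Tuple.sort_eq_refl_iff_monotone.2 fun i j hij => neg_le_neg (hv hij)
  ext j
  simp [sortDesc, h]

theorem sum_sortDesc (v : Fin d → ℝ) : ∑ j, sortDesc v j = ∑ i, v i :=
  Equiv.sum_comp (Tuple.sort fun i => -v i) v

theorem sum_filter_val_lt_succ {M : Type*} [AddCommMonoid M] (g : Fin d → M) {n : ℕ}
    (hn : n < d) :
    ∑ j : Fin d with j.val < n + 1, g j = (∑ j : Fin d with j.val < n, g j) + g ⟨n, hn⟩ := by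
  have : (Finset.univ.filter fun j : Fin d => j.val < n + 1) =
      insert ⟨n, hn⟩ (Finset.univ.filter fun j : Fin d => j.val < n) := by
    ext j
    simp only [Finset.mem_filter, Finset.mem_univ, true_and, Finset.mem_insert, Fin.ext_iff]
    omega
  rw [this, Finset.sum_insert (by simp), add_comm]

theorem sum_filter_val_lt_of_le {M : Type*} [AddCommMonoid M] (g : Fin d → M) {n : ℕ}
    (hn : d ≤ n) : ∑ j : Fin d with j.val < n, g j = ∑ j, g j := by
  rw [Finset.filter_true_of_mem fun j _ => j.isLt.trans_le hn]

/-- Summation by parts against a decreasing sequence. -/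
theorem mul_sum_le_sum_mul {C t : Fin d → ℝ} (hC : Antitone C)
    (ht : ∀ k, 1 ≤ k → k ≤ d → 0 ≤ ∑ j : Fin d with j.val < k, t j) (n : ℕ) (hn : n < d) :
    C ⟨n, hn⟩ * ∑ j : Fin d with j.val < n + 1, t j ≤
      ∑ j : Fin d with j.val < n + 1, C j * t j := by
  induction n with
  | zero =>
    rw [sum_filter_val_lt_succ t hn, sum_filter_val_lt_succ _ hn]
    simp
  | succ n ih =>
    have h1 := ih (by omega)
    have h2 : C ⟨n + 1, hn⟩ ≤ C ⟨n, by omega⟩ := hC (by simp)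
    have h3 := mul_le_mul_of_nonneg_right h2 (ht (n + 1) (by omega) (by omega))
    rw [sum_filter_val_lt_succ t hn, sum_filter_val_lt_succ _ hn, mul_add]
    linarith

/-- Summation by parts is applied to `u - s`, whose total vanishes, so the boundary term drops out.
-/
theorem sum_mul_le_of_partial_sums {C s u : Fin d → ℝ} (hC : Antitone C)
    (h : ∀ k, 1 ≤ k → k ≤ d →
      ∑ j : Fin d with j.val < k, s j ≤ ∑ j : Fin d with j.val < k, u j)
    (hsum : ∑ j, s j = ∑ j, u j) : ∑ j, C j * s j ≤ ∑ j, C j * u j := by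
  rcases Nat.eq_zero_or_pos d with rfl | hd
  · simp
  have h1 := mul_sum_le_sum_mul (C := C) (t := u - s) hC
    (fun k hk hkd => by simpa [Finset.sum_sub_distrib] using h k hk hkd) (d - 1) (by omega)
  rw [sum_filter_val_lt_of_le _ (by omega), sum_filter_val_lt_of_le _ (by omega)] at h1
  simp only [Pi.sub_apply, Finset.sum_sub_distrib, hsum, sub_self, mul_zero, mul_sub] at h1
  linarith

/-- Rado's theorem: a vector majorized by `u` is a convex combination of permutations of `u`. -/
theorem Majorized.mem_convexHull {v u : Fin d → ℝ} (hu : Antitone u) (h : Majorized v u) :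
    v ∈ convexHull ℝ (Set.range fun σ : Equiv.Perm (Fin d) => u ∘ σ) := by
  by_contra hv
  -- Separate `v` from the hull by `f`, with coefficients `C`. Rearrangement and summation by parts
  -- give `f v ≤ f (u ∘ τ.symm)`, where `τ` sorts `C`; this contradicts separation.
  obtain ⟨f, c, hlt, hgt⟩ := geometric_hahn_banach_closed_point (convex_convexHull ℝ _)
    ((Set.finite_range _).isClosed_convexHull (𝕜 := ℝ)) hv
  let C : Fin d → ℝ := fun i => f (Pi.single i 1)
  have hf : ∀ x, f x = ∑ i, C i * x i := fun x => by
    have := LinearMap.pi_apply_eq_sum_univ (f : (Fin d → ℝ) →ₗ[ℝ] ℝ) x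
    simp only [ContinuousLinearMap.coe_coe, smul_eq_mul] at this
    rw [this]
    refine Finset.sum_congr rfl fun i _ => ?_
    rw [mul_comm]
    congr 2
    ext j
    simp [Pi.single_apply, eq_comm]
  let τ : Equiv.Perm (Fin d) := Tuple.sort fun i => -C i
  let ρ : Equiv.Perm (Fin d) := Tuple.sort fun i => -v i
  have hC : Antitone (C ∘ τ) := antitone_sortDesc C
  have h1 : ∑ i, C i * v i ≤ ∑ j, (C ∘ τ) j * sortDesc v j := by
    have hm : Monovary (C ∘ τ) (sortDesc v) := hC.monovary (antitone_sortDesc v)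
    have := hm.sum_mul_comp_perm_le_sum_mul (σ := τ.trans ρ.symm)
    rw [← Equiv.sum_comp τ fun i => C i * v i]
    simpa [sortDesc, ρ] using this
  have h2 : ∑ j, (C ∘ τ) j * sortDesc v j ≤ ∑ j, (C ∘ τ) j * u j := by
    refine sum_mul_le_of_partial_sums hC (fun k hk hkd => ?_) ?_
    · have := h.1 k hk hkd
      simpa only [topSum, sortDesc_eq_of_antitone hu] using this
    · rw [sum_sortDesc, h.2]
  have h3 : ∑ j, (C ∘ τ) j * u j = f (u ∘ τ.symm) := by
    rw [hf, ← Equiv.sum_comp τ fun i => C i * (u ∘ τ.symm) i]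
    simp
  have h4 := hlt _ (subset_convexHull ℝ _ ⟨τ.symm, rfl⟩)
  rw [hf v] at hgt
  linarith

theorem sum_filter_val_lt_const {k : ℕ} (hk : k ≤ d) :
    ∑ j : Fin d with j.val < k, (1 : ℝ) = k := by
  induction k with
  | zero => simp
  | succ k ih => rw [sum_filter_val_lt_succ _ hk, ih (by omega)]; push_cast; rfl

theorem sum_filter_val_lt_ite {k a : ℕ} (ha : a < d) (c : ℝ) :
    ∑ j : Fin d with j.val < k, (if j.val = a then c else 0) = if a < k then c else 0 := by
  rw [Finset.sum_filter]
  rw [Finset.sum_eq_single ⟨a, ha⟩]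
  · simp
  · intro j _ hj
    have : j.val ≠ a := fun h => hj (Fin.ext h)
    simp [this]
  · simp

/-! ### Partial sums of the vertex vectors, and majorization by them -/

variable {N : ℕ}

theorem antitone_oneVertex : Antitone (oneVertex N d) := by
  intro i j hij
  have : i.val ≤ j.val := hij
  simp only [oneVertex]
  split_ifs <;> first | omega | norm_num

theorem antitone_twoVertex {w₁ w₂ : ℝ} (h : w₂ ≤ w₁) (h0 : 0 ≤ w₂) (hs : w₁ + w₂ = 1) :
    Antitone (twoVertex N d w₁ w₂) := by
  intro i j hij
  have : i.val ≤ j.val := hij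
  simp only [twoVertex]
  split_ifs <;> first | omega | linarith

theorem sum_filter_oneVertex (hd : N ≤ d) {k : ℕ} (hk : N ≤ k) :
    ∑ j : Fin d with j.val < k, oneVertex N d j = N := by
  rw [← sum_filter_val_lt_const hd]
  simp only [oneVertex]
  rw [← Finset.sum_filter, Finset.filter_filter]
  congr 1
  ext j
  simp only [Finset.mem_filter, Finset.mem_univ, true_and]
  omega

/-- Weight `w₂` moves from position `N - 1` (counted from 0) to position `N`, so only the `N`-th
partial sum changes. -/
theorem twoVertex_eq [NeZero N] {w₁ w₂ : ℝ} (hs : w₁ + w₂ = 1) (j : Fin d) :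
    twoVertex N d w₁ w₂ j = oneVertex N d j - (if j.val = N - 1 then w₂ else 0) +
      (if j.val = N then w₂ else 0) := by
  have := NeZero.pos N
  simp only [twoVertex, oneVertex]
  split_ifs <;> first | omega | linarith

theorem sum_filter_twoVertex [NeZero N] {w₁ w₂ : ℝ} (hs : w₁ + w₂ = 1) (hd : N + 1 ≤ d) {k : ℕ}
    (hk : N ≤ k) :
    ∑ j : Fin d with j.val < k, twoVertex N d w₁ w₂ j =
      (N : ℝ) - w₂ + if N < k then w₂ else 0 := by
  have := NeZero.pos N
  simp only [twoVertex_eq hs, Finset.sum_add_distrib, Finset.sum_sub_distrib]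
  rw [sum_filter_oneVertex (by omega) hk, sum_filter_val_lt_ite (by omega),
    sum_filter_val_lt_ite (by omega), if_pos (by omega)]

theorem sortDesc_le_one {lam : Fin d → ℝ} (hd : 0 < d) (h : sortDesc lam ⟨0, hd⟩ ≤ 1)
    (j : Fin d) : sortDesc lam j ≤ 1 :=
  (antitone_sortDesc lam (by simp [Fin.le_def])).trans h

theorem topSum_le_sum {lam : Fin d → ℝ} (h0 : ∀ i, 0 ≤ lam i) (k : ℕ) :
    topSum lam k ≤ ∑ i, lam i := by
  rw [← sum_sortDesc]
  exact Finset.sum_le_sum_of_subset_of_nonneg (Finset.subset_univ _) fun j _ _ => h0 _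

theorem majorized_oneVertex {lam : Fin d → ℝ} (hd : N ≤ d) (hd0 : 0 < d) (h0 : ∀ i, 0 ≤ lam i)
    (hs : ∑ i, lam i = N) (h1 : sortDesc lam ⟨0, hd0⟩ ≤ 1) : Majorized lam (oneVertex N d) := by
  refine ⟨fun k _ hk => ?_, ?_⟩
  · rw [topSum, topSum, sortDesc_eq_of_antitone antitone_oneVertex]
    rcases le_total k N with hkN | hkN
    · refine Finset.sum_le_sum fun j hj => ?_
      have hj' : j.val < k := by simpa using hj
      rw [oneVertex, if_pos (by omega)]
      exact sortDesc_le_one hd0 h1 j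
    · rw [sum_filter_oneVertex hd hkN, ← hs]
      exact topSum_le_sum h0 k
  · rw [hs, ← sum_filter_oneVertex hd hd, sum_filter_val_lt_of_le _ le_rfl]

/-- Below `N` compare entrywise with 1; beyond `N` the vertex has already reached the total, which
bounds `topSum lam k` by nonnegativity. Only `k = N` needs `hN`. -/
theorem majorized_twoVertex [NeZero N] {lam : Fin d → ℝ} {w₁ w₂ : ℝ} (h21 : w₂ ≤ w₁)
    (h20 : 0 ≤ w₂) (hw : w₁ + w₂ = 1) (hd : N + 1 ≤ d) (hd0 : 0 < d) (h0 : ∀ i, 0 ≤ lam i)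
    (hs : ∑ i, lam i = N) (h1 : sortDesc lam ⟨0, hd0⟩ ≤ 1)
    (hN : topSum lam N ≤ (N : ℝ) - 1 + w₁) : Majorized lam (twoVertex N d w₁ w₂) := by
  refine ⟨fun k _ hk => ?_, ?_⟩
  · rw [topSum, topSum, sortDesc_eq_of_antitone (antitone_twoVertex h21 h20 hw)]
    rcases lt_trichotomy k N with hkN | rfl | hkN
    · refine Finset.sum_le_sum fun j hj => ?_
      have hj' : j.val < k := by simpa using hj
      rw [twoVertex, if_pos (by omega)]
      exact sortDesc_le_one hd0 h1 j
    · rw [sum_filter_twoVertex hw hd le_rfl, if_neg (lt_irrefl _)]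
      refine le_trans hN ?_
      linarith
    · rw [sum_filter_twoVertex hw hd hkN.le, if_pos hkN, sub_add_cancel, ← hs]
      exact topSum_le_sum h0 k
  · rw [hs, ← sum_filter_val_lt_of_le (twoVertex N d w₁ w₂) le_rfl,
      sum_filter_twoVertex hw hd (by omega), if_pos (by omega), sub_add_cancel]

/-- Turns the sorted sum into one of the linear forms that define `slaterBound`. -/
theorem topSum_eq_sum_injective (lam : Fin d → ℝ) (hd : N ≤ d) :
    ∃ f : Fin N → Fin d, Function.Injective f ∧ topSum lam N = ∑ m, lam (f m) := by
  refine ⟨fun m => Tuple.sort (fun i => -lam i) (Fin.castLE hd m),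
    (Equiv.injective _).comp (Fin.castLE_injective hd), ?_⟩
  symm
  refine Finset.sum_bij (fun m _ => Fin.castLE hd m) ?_ ?_ ?_ ?_
  · simp
  · intro a _ c _ h
    exact Fin.castLE_injective hd h
  · intro j hj
    exact ⟨⟨j, by simpa using hj⟩, Finset.mem_univ _, rfl⟩
  · intro m _
    rfl

end Majorization

/-! ### Slater determinants and the vertices of the polytope -/

section Vertices

variable {N d : ℕ}

/-- Normalize `x ↦ det (δ_{f i, x j})`: permuting `x` permutes columns, and an `x m` outside the
range of `f` gives a zero column. -/
theorem exists_slater {f : Fin N → Fin d} (hf : Function.Injective f) :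
    ∃ Ψ : fermionSpace N d, ‖Ψ‖ = 1 ∧
      ∀ x, (Ψ : NParticle N d) x ≠ 0 → ∃ σ : Equiv.Perm (Fin N), x = f ∘ σ := by
  let M : (Fin N → Fin d) → Matrix (Fin N) (Fin N) ℂ := fun x =>
    Matrix.of fun i j => if f i = x j then 1 else 0
  have hanti : ∀ (σ : Equiv.Perm (Fin N)) x,
      (M (x ∘ σ)).det = ((Equiv.Perm.sign σ : ℤ) : ℂ) * (M x).det := fun σ x =>
    Matrix.det_permute' σ (M x)
  let Φ : fermionSpace N d := ⟨WithLp.toLp 2 fun x => (M x).det, hanti⟩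
  have hsupp : ∀ x, (M x).det ≠ 0 → ∃ σ : Equiv.Perm (Fin N), x = f ∘ σ := by
    intro x hx
    refine exists_perm_of_image_eq (injective_of_antisymm (c := fun x => (M x).det) hanti hx) ?_
    intro m
    by_contra hm
    refine hx (Matrix.det_eq_zero_of_column_eq_zero m fun i => ?_)
    exact if_neg fun h => hm ⟨i, h⟩
  have hff : (M f).det = 1 := by
    have : M f = 1 := by
      ext i j
      simp [M, Matrix.one_apply, hf.eq_iff]
    rw [this, Matrix.det_one]
  have hΦ : Φ ≠ 0 := by
    intro h
    have h1 : (Φ : NParticle N d) f = 0 := by rw [h]; rfl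
    exact one_ne_zero (hff.symm.trans h1)
  refine ⟨((‖Φ‖ : ℂ)⁻¹) • Φ, norm_smul_inv_norm hΦ, fun x hx => hsupp x fun h => hx ?_⟩
  change ((‖Φ‖ : ℂ)⁻¹) * (M x).det = 0
  rw [h, mul_zero]

/-- The RDM of a Slater determinant is the projection onto its orbitals: altering a single slot of a
rearrangement of `f` never yields another one, so off-diagonal entries vanish. -/
theorem rdm_sum_of_support [NeZero N] {f : Fin N → Fin d} (hf : Function.Injective f)
    {Ψ : fermionSpace N d} (hn : ‖Ψ‖ = 1)
    (hs : ∀ x, (Ψ : NParticle N d) x ≠ 0 → ∃ σ : Equiv.Perm (Fin N), x = f ∘ σ)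
    (a a' : Fin d) :
    (N : ℂ) * ∑ x : Fin N → Fin d with x 0 = a, (Ψ : NParticle N d) x *
        starRingEnd ℂ ((Ψ : NParticle N d) (Function.update x 0 a')) =
      if a = a' then (if a ∈ Finset.univ.image f then 1 else 0) else 0 := by
  split_ifs with haa ha
  all_goals try subst haa
  · have h := mul_sum_filter_zero (q := fun x => ‖(Ψ : NParticle N d) x‖ ^ 2)
      (norm_sq_comp_perm Ψ.2) (fun y hy => injective_of_antisymm Ψ.2 fun h => hy (by simp [h])) a
    have h1 : ∑ y : Fin N → Fin d with a ∈ Finset.univ.image y, ‖(Ψ : NParticle N d) y‖ ^ 2 =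
        1 := by
      have h2 : ∑ y, ‖(Ψ : NParticle N d) y‖ ^ 2 = 1 := by
        rw [← EuclideanSpace.norm_sq_eq, ← Submodule.coe_norm, hn, one_pow]
      rw [← h2, Finset.sum_filter]
      refine Finset.sum_congr rfl fun y _ => ?_
      split_ifs with hy
      · rfl
      · by_contra hne
        obtain ⟨σ, rfl⟩ := hs y fun h => hne (by simp [h])
        obtain ⟨m, -, rfl⟩ := Finset.mem_image.1 ha
        exact hy (Finset.mem_image.2 ⟨σ.symm m, Finset.mem_univ _, by simp⟩)
    rw [h1] at h
    have h3 := congrArg (fun r : ℝ => (r : ℂ)) h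
    push_cast at h3
    rw [← h3]
    congr 1
    refine Finset.sum_congr rfl fun x hx => ?_
    have hx0 : x 0 = a := by simpa using hx
    rw [← hx0, Function.update_eq_self, Complex.mul_conj']
  · rw [Finset.sum_eq_zero, mul_zero]
    intro x hx
    have hx0 : x 0 = a := by simpa using hx
    by_contra hne
    obtain ⟨σ, rfl⟩ := hs x (left_ne_zero_of_mul hne)
    exact ha (Finset.mem_image.2 ⟨σ 0, Finset.mem_univ _, hx0⟩)
  · rw [Finset.sum_eq_zero, mul_zero]
    intro x hx
    have hx0 : x 0 = a := by simpa using hx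
    by_contra hne
    obtain ⟨σ, rfl⟩ := hs x (left_ne_zero_of_mul hne)
    obtain ⟨τ, hτ⟩ := hs (Function.update (f ∘ σ) 0 a')
      fun h => right_ne_zero_of_mul hne (by rw [h, map_zero])
    have h0 : f (τ 0) = a' := by simpa using (congrFun hτ 0).symm
    -- `m` is the slot where `σ` places the orbital `f (τ 0) = a'`. If `m = 0` then `a = a'`;
    -- otherwise slot `m` is unchanged, so `τ m = τ 0`.
    obtain ⟨m, hm⟩ := σ.surjective (τ 0)
    by_cases hm0 : m = 0
    · subst hm0
      refine haa ?_
      rw [← hx0, ← h0, ← hm]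
      rfl
    · have h1 := congrFun hτ m
      rw [Function.update_of_ne hm0] at h1
      have h2 : σ m = τ m := hf h1
      exact hm0 (τ.injective (h2.symm.trans hm))

/-- The operator that is diagonal in the standard basis with entries `v`. -/
def diagOp (d : ℕ) : (Fin d → ℝ) →ₗ[ℝ] (OneParticle d →ₗ[ℂ] OneParticle d) where
  toFun v := Matrix.toEuclideanLin (Matrix.diagonal fun i => (v i : ℂ))
  map_add' v u := by
    rw [← map_add, Matrix.diagonal_add]
    simp
  map_smul' c v := by
    ext u i
    simp [Matrix.toLpLin_apply, Matrix.mulVec_diagonal, mul_assoc]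

theorem hasSpec_diagOp (v : Fin d → ℝ) : HasSpec (H := OneParticle d) (diagOp d v) v := by
  refine ⟨EuclideanSpace.basisFun (Fin d) ℂ, fun i => ?_⟩
  ext j
  simp only [diagOp, LinearMap.coe_mk, AddHom.coe_mk, EuclideanSpace.basisFun_apply,
    Matrix.toLpLin_apply, Matrix.mulVec_diagonal, PiLp.smul_apply, smul_eq_mul,
    PiLp.single_apply]
  split_ifs with h
  · rw [h]
  · simp

/-- The conditions concern only `w k ≠ 0`, since the other basis vectors come from an arbitrary
completion. -/
theorem oneRDM_eq_diagOp [NeZero N] {ι : Type*} [Fintype ι] {Γ : FermionOp N d} {w : ι → ℝ}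
    {B : OrthonormalBasis ι ℂ (fermionSpace N d)} (hB : ∀ k, Γ (B k) = (w k : ℂ) • B k)
    {F : ι → Fin N → Fin d} (hF : ∀ k, w k ≠ 0 → Function.Injective (F k))
    (hs : ∀ k, w k ≠ 0 → ∀ x, (B k : NParticle N d) x ≠ 0 →
      ∃ σ : Equiv.Perm (Fin N), x = F k ∘ σ) :
    oneRDM Γ = diagOp d fun i => ∑ k, w k * if i ∈ Finset.univ.image (F k) then 1 else 0 := by
  rw [oneRDM_eq hB]
  change _ = Matrix.toEuclideanLin _
  congr 1
  ext a a'
  rw [Matrix.of_apply, rdmEntry, Finset.mul_sum, Matrix.diagonal_apply]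
  have h : ∀ k, (N : ℂ) * ((w k : ℂ) * ∑ x : Fin N → Fin d with x 0 = a,
      (B k : NParticle N d) x *
        starRingEnd ℂ ((B k : NParticle N d) (Function.update x 0 a'))) =
      if a = a' then (w k : ℂ) * (if a ∈ Finset.univ.image (F k) then 1 else 0) else 0 := by
    intro k
    by_cases hk : w k = 0
    · simp [hk]
    rw [mul_left_comm, rdm_sum_of_support (hF k hk) (B.norm_eq_one k) (hs k hk)]
    split_ifs <;> simp
  simp only [h]
  split_ifs with haa
  · rw [Complex.ofReal_sum]
    refine Finset.sum_congr rfl fun k _ => ?_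
    split_ifs <;> simp
  · simp

theorem isDensity_of_hasSpec {H : Type*} [NormedAddCommGroup H] [InnerProductSpace ℂ H]
    [FiniteDimensional ℂ H] {ι : Type*} [Fintype ι] {T : H →ₗ[ℂ] H} {w : ι → ℝ}
    (hw : ∀ k, 0 ≤ w k) (hs : ∑ k, w k = 1) (hT : HasSpec T w) : IsDensity T := by
  obtain ⟨B, hB⟩ := hT
  have h : ∀ u v, inner ℂ (T u) v = ∑ k, (w k : ℂ) * (inner ℂ u (B k) * inner ℂ (B k) v) := by
    intro u v
    rw [HasSpec.apply_eq_sum hB, sum_inner]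
    refine Finset.sum_congr rfl fun k _ => ?_
    rw [inner_smul_left, map_mul, Complex.conj_ofReal, inner_conj_symm, mul_assoc]
  refine ⟨⟨fun u v => ?_, fun u => ?_⟩, ?_⟩
  · rw [h, ← inner_conj_symm, h, map_sum]
    refine Finset.sum_congr rfl fun k _ => ?_
    simp only [map_mul, Complex.conj_ofReal, inner_conj_symm]
    ring
  · rw [h, map_sum]
    refine Finset.sum_nonneg fun k _ => ?_
    rw [← inner_conj_symm u (B k), Complex.conj_mul', ← Complex.ofReal_pow,
      ← Complex.ofReal_mul]
    exact mul_nonneg (hw k) (sq_nonneg _)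
  · classical
    rw [LinearMap.trace_eq_sum_inner T B]
    have h2 : ∀ k, inner ℂ (B k) (T (B k)) = (w k : ℂ) := fun k => by
      rw [hB k, inner_smul_right, orthonormal_iff_ite.1 B.orthonormal, if_pos rfl, mul_one]
    simp only [h2]
    rw [← Complex.ofReal_sum, hs, Complex.ofReal_one]

/-- The given vectors occupy the first `r` positions, matching the nonzero entries of the weight
vector. -/
theorem exists_basis_extending {E : Type*} [NormedAddCommGroup E] [InnerProductSpace ℂ E]
    [FiniteDimensional ℂ E] {r : ℕ} {ψ : Fin r → E} (hψ : Orthonormal ℂ ψ) :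
    ∃ (hr : r ≤ Module.finrank ℂ E) (B : OrthonormalBasis (Fin (Module.finrank ℂ E)) ℂ E),
      ∀ m, B (Fin.castLE hr m) = ψ m := by
  have hr : r ≤ Module.finrank ℂ E := by
    simpa using hψ.linearIndependent.fintype_card_le_finrank
  let v : Fin (Module.finrank ℂ E) → E := fun k => if h : k.val < r then ψ ⟨k, h⟩ else 0
  have hv : Orthonormal ℂ (Set.domRestrict {k | k.val < r} v) := by
    have : Set.domRestrict {k | k.val < r} v =
        ψ ∘ fun k : {k : Fin (Module.finrank ℂ E) | k.val < r} => ⟨k.1, k.2⟩ := by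
      ext k
      have hk : (k : Fin (Module.finrank ℂ E)).val < r := k.2
      rw [Set.domRestrict_apply]
      exact dif_pos hk
    rw [this]
    refine hψ.comp _ fun k l hkl => ?_
    exact Subtype.ext (Fin.ext (Fin.mk.inj hkl))
  obtain ⟨B, hB⟩ := hv.exists_orthonormalBasis_extension_of_card_eq (by simp)
  refine ⟨hr, B, fun m => ?_⟩
  rw [hB _ (by simp)]
  simp [v]

/-- Mixtures of orthogonal Slater determinants realize mixtures of indicator vectors. -/
theorem diagOp_mem_oneRDMs [NeZero N] {r : ℕ} {p : Fin r → ℝ} (hp : ∀ m, 0 ≤ p m)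
    (hs : ∑ m, p m = 1) {F : Fin r → Fin N → Fin d} (hF : ∀ m, Function.Injective (F m))
    (hdisj : ∀ m m', m ≠ m' → ∀ σ : Equiv.Perm (Fin N), F m ≠ F m' ∘ σ)
    {w : Fin (fermionDim N d) → ℝ} (hw : ∀ k, w k = if h : k.val < r then p ⟨k, h⟩ else 0) :
    diagOp d (fun i => ∑ m, p m * if i ∈ Finset.univ.image (F m) then 1 else 0) ∈
      oneRDMs N d w := by
  choose ψ hn hsupp using fun m => exists_slater (hF m)
  have hψ : Orthonormal ℂ ψ := by
    refine ⟨hn, fun m m' hmm => ?_⟩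
    change inner ℂ (ψ m) (ψ m') = 0
    rw [Submodule.coe_inner, PiLp.inner_apply]
    -- Distinct determinants have disjoint supports, by `hdisj`.
    refine Finset.sum_eq_zero fun x _ => ?_
    by_contra hne
    rw [RCLike.inner_apply] at hne
    obtain ⟨σ, hσ⟩ := hsupp m x fun h => right_ne_zero_of_mul hne (by rw [h, map_zero])
    obtain ⟨τ, hτ⟩ := hsupp m' x (left_ne_zero_of_mul hne)
    refine hdisj m m' hmm (σ.symm.trans τ) ?_
    have h1 : F m ∘ σ = F m' ∘ τ := hσ.symm.trans hτ
    ext a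
    have := congrFun h1 (σ.symm a)
    simpa using congrArg Fin.val this
  obtain ⟨hr, B, hB⟩ := exists_basis_extending hψ
  change Fin (Module.finrank ℂ (fermionSpace N d)) → ℝ at w
  have hr0 : 0 < r := by
    rcases Nat.eq_zero_or_pos r with rfl | h
    · simp at hs
    · exact h
  -- The value for `k ≥ r` is a dummy: `w k = 0` there.
  let G : Fin (Module.finrank ℂ (fermionSpace N d)) → Fin N → Fin d := fun k =>
    if h : k.val < r then F ⟨k, h⟩ else F ⟨0, hr0⟩
  have hwr : ∀ k, w k ≠ 0 → k.val < r := fun k hk => by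
    by_contra h
    exact hk ((hw k).trans (dif_neg h))
  have hw0 : ∀ k, 0 ≤ w k := fun k => by
    have := hw k
    split_ifs at this
    · rw [this]; exact hp _
    · rw [this]
  have hsum : ∀ g : Fin (Module.finrank ℂ (fermionSpace N d)) → ℝ,
      ∑ k, w k * g k = ∑ m, p m * g (Fin.castLE hr m) := by
    intro g
    symm
    refine Finset.sum_of_injOn (Fin.castLE hr) (Fin.castLE_injective hr).injOn (by simp) ?_ ?_
    · intro k _ hk
      have : w k = 0 := by
        by_contra h
        exact hk ⟨⟨k, hwr k h⟩, by simp, rfl⟩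
      rw [this, zero_mul]
    · intro m _
      have : w (Fin.castLE hr m) = p m := (hw _).trans (dif_pos m.2)
      rw [this]
  let Γ : FermionOp N d := B.toBasis.constr ℂ fun k => (w k : ℂ) • B k
  have hΓ : ∀ k, Γ (B k) = (w k : ℂ) • B k := fun k => by
    have := B.toBasis.constr_basis ℂ (fun k => (w k : ℂ) • B k) k
    rwa [B.coe_toBasis] at this
  have hspec : HasSpec (H := fermionSpace N d) Γ w := ⟨B, hΓ⟩
  refine ⟨Γ, ⟨isDensity_of_hasSpec hw0 ?_ hspec, hspec⟩, ?_⟩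
  · have := hsum fun _ => 1
    simpa only [mul_one, hs] using this
  · have hBk : ∀ (k) (hk : k.val < r), B k = ψ ⟨k, hk⟩ := fun k hk => hB ⟨k, hk⟩
    rw [oneRDM_eq_diagOp hΓ (F := G)]
    · congr 1
      ext i
      rw [hsum]
      simp [G]
    · intro k hk
      simp only [G, dif_pos (hwr k hk)]
      exact hF _
    · intro k hk
      rw [hBk k (hwr k hk)]
      simp only [G, dif_pos (hwr k hk)]
      exact hsupp _

theorem oneVertex_comp_mem [NeZero N] (hd : N ≤ d) (σ : Equiv.Perm (Fin d)) :
    diagOp d (oneVertex N d ∘ σ) ∈ oneRDMs N d (twoWeights (fermionDim N d) 1 0) := by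
  have h := diagOp_mem_oneRDMs (N := N) (d := d) (r := 1) (p := fun _ => 1) (by simp) (by simp)
    (F := fun _ m => σ.symm (Fin.castLE hd m))
    (fun _ => σ.symm.injective.comp (Fin.castLE_injective hd))
    (fun m m' hm => absurd (Subsingleton.elim m m') hm)
    (w := twoWeights (fermionDim N d) 1 0) (fun k => by simp [twoWeights])
  convert h using 2
  ext i
  simp only [Function.comp_apply, oneVertex, Finset.univ_unique, Finset.sum_singleton, one_mul]
  congr 1
  simp only [Finset.mem_image, Finset.mem_univ, true_and, eq_iff_iff]
  constructor
  · intro hi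
    exact ⟨⟨σ i, hi⟩, by rw [Equiv.symm_apply_eq]; rfl⟩
  · rintro ⟨m, rfl⟩
    simp

theorem twoVertex_comp_mem [NeZero N] {w₁ w₂ : ℝ} (h21 : w₂ ≤ w₁)
    (h20 : 0 ≤ w₂) (hw : w₁ + w₂ = 1) (hd : N + 1 ≤ d) (σ : Equiv.Perm (Fin d)) :
    diagOp d (twoVertex N d w₁ w₂ ∘ σ) ∈ oneRDMs N d (twoWeights (fermionDim N d) w₁ w₂) := by
  have hN := NeZero.pos N
  -- Orbitals `0, …, N - 2` and `N`: the second determinant replaces orbital `N - 1` of the first by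
  -- `N`, before `σ.symm` relabels.
  let g : Fin N → Fin d := fun m => if m.val + 1 < N then ⟨m, by omega⟩ else ⟨N, hd⟩
  have hgi : Function.Injective g := by
    intro m m' h
    simp only [g] at h
    split_ifs at h <;> simp only [Fin.mk.injEq] at h <;> ext <;> omega
  let F : Fin 2 → Fin N → Fin d :=
    ![fun m => σ.symm (Fin.castLE (by omega) m), fun m => σ.symm (g m)]
  have hlast : g ⟨N - 1, by omega⟩ = ⟨N, hd⟩ := if_neg (by simp; omega)
  have hmem0 : ∀ i, i ∈ Finset.univ.image (F 0) ↔ (σ i).val < N := by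
    intro i
    simp only [F, Matrix.cons_val_zero, Finset.mem_image, Finset.mem_univ, true_and]
    constructor
    · rintro ⟨m, rfl⟩
      simp
    · intro hi
      exact ⟨⟨σ i, hi⟩, by rw [Equiv.symm_apply_eq]; rfl⟩
  have hmem1 : ∀ i, i ∈ Finset.univ.image (F 1) ↔ (σ i).val + 1 < N ∨ (σ i).val = N := by
    intro i
    simp only [F, Matrix.cons_val_one, Matrix.cons_val_fin_one, Finset.mem_image,
      Finset.mem_univ, true_and]
    constructor
    · rintro ⟨m, rfl⟩
      simp only [Equiv.apply_symm_apply, g]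
      split_ifs with h
      · exact Or.inl h
      · exact Or.inr rfl
    · rintro (hi | hi)
      · refine ⟨⟨σ i, by omega⟩, ?_⟩
        rw [Equiv.symm_apply_eq]
        exact if_pos hi
      · refine ⟨⟨N - 1, by omega⟩, ?_⟩
        rw [Equiv.symm_apply_eq, hlast]
        exact Fin.ext hi.symm
  have hne : Finset.univ.image (F 0) ≠ Finset.univ.image (F 1) := by
    intro h
    have h1 := hmem1 (σ.symm ⟨N, hd⟩)
    rw [← h, hmem0] at h1
    simp at h1
  have himg : ∀ (f : Fin N → Fin d) (τ : Equiv.Perm (Fin N)),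
      Finset.univ.image (f ∘ τ) = Finset.univ.image f := by
    intro f τ
    ext i
    simp only [Finset.mem_image, Finset.mem_univ, true_and, Function.comp_apply]
    exact τ.exists_congr_left.trans (by simp)
  have h := diagOp_mem_oneRDMs (N := N) (d := d) (r := 2) (p := ![w₁, w₂])
    (fun m => by fin_cases m <;> simp <;> linarith) (by simpa using hw) (F := F)
    (fun m => by
      fin_cases m
      · exact σ.symm.injective.comp (Fin.castLE_injective _)
      · exact σ.symm.injective.comp hgi)
    (fun m m' hm τ h => by
      have h2 : Finset.univ.image (F m) = Finset.univ.image (F m') := by rw [h, himg]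
      fin_cases m <;> fin_cases m'
      · exact hm rfl
      · exact hne h2
      · exact hne h2.symm
      · exact hm rfl)
    (w := twoWeights (fermionDim N d) w₁ w₂) (fun k => by
      obtain ⟨_ | _ | k, hk⟩ := k <;> simp [twoWeights])
  convert h using 2
  ext i
  simp only [Function.comp_apply, twoVertex, Fin.sum_univ_two, hmem0, hmem1,
    Matrix.cons_val_zero, Matrix.cons_val_one, Matrix.cons_val_fin_one]
  split_ifs <;> first | omega | linarith

/-- `diagOp` is linear, so it carries Rado's convex combination into the hull of the RDMs. -/
theorem Majorized.mem_spectralPolytope [NeZero N] {u lam : Fin d → ℝ} (hu : Antitone u)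
    {w : Fin (fermionDim N d) → ℝ}
    (hmem : ∀ σ : Equiv.Perm (Fin d), diagOp d (u ∘ σ) ∈ oneRDMs N d w)
    (h : Majorized lam u) : lam ∈ spectralPolytope N d w := by
  refine ⟨diagOp d lam, ?_, hasSpec_diagOp lam⟩
  have h1 : convexHull ℝ (Set.range fun σ : Equiv.Perm (Fin d) => u ∘ σ) ⊆
      diagOp d ⁻¹' convexHull ℝ (oneRDMs N d w) := by
    refine convexHull_min ?_ ((convex_convexHull ℝ _).linear_preimage (diagOp d))
    rintro _ ⟨σ, rfl⟩
    exact subset_convexHull ℝ _ (hmem σ)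
  exact h1 (h.mem_convexHull hu)

end Vertices

end WRDMFT

end

open WRDMFT

theorem mainTheorem3 (N d : ℕ) [NeZero N] :
    (∀ (w₁ w₂ : ℝ) (_ : w₂ ≤ w₁) (_ : 0 ≤ w₂) (_ : w₁ + w₂ = 1) (hd : N + 1 ≤ d),
      WRDMFT.spectralPolytope N d (WRDMFT.twoWeights (WRDMFT.fermionDim N d) w₁ w₂) =
        {lam : Fin d → ℝ | WRDMFT.Majorized lam (WRDMFT.twoVertex N d w₁ w₂)} ∧
      WRDMFT.spectralPolytope N d (WRDMFT.twoWeights (WRDMFT.fermionDim N d) w₁ w₂) =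
        {lam : Fin d → ℝ | (∀ i, 0 ≤ lam i) ∧ ∑ i, lam i = (N : ℝ) ∧
          WRDMFT.sortDesc lam ⟨0, lt_of_lt_of_le (Nat.succ_pos N) hd⟩ ≤ 1 ∧
          ∑ j : Fin d with j.val < N, WRDMFT.sortDesc lam j ≤ (N : ℝ) - 1 + w₁}) ∧
    (∀ (hd : N ≤ d),
      WRDMFT.spectralPolytope N d (WRDMFT.twoWeights (WRDMFT.fermionDim N d) 1 0) =
        {lam : Fin d → ℝ | WRDMFT.Majorized lam (WRDMFT.oneVertex N d)} ∧
      WRDMFT.spectralPolytope N d (WRDMFT.twoWeights (WRDMFT.fermionDim N d) 1 0) =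
        {lam : Fin d → ℝ | (∀ i, 0 ≤ lam i) ∧ ∑ i, lam i = (N : ℝ) ∧
          WRDMFT.sortDesc lam ⟨0, lt_of_lt_of_le (NeZero.pos N) hd⟩ ≤ 1}) := by
  have hweights : ∀ {w₁ w₂ : ℝ}, w₂ ≤ w₁ → 0 ≤ w₂ → ∀ k,
      0 ≤ twoWeights (fermionDim N d) w₁ w₂ k ∧ twoWeights (fermionDim N d) w₁ w₂ k ≤ w₁ := by
    intro w₁ w₂ h21 h20 k
    simp only [twoWeights]
    split_ifs <;> constructor <;> linarith
  have hcycle : ∀ {S A C : Set (Fin d → ℝ)}, S ⊆ C → C ⊆ A → A ⊆ S → S = A ∧ S = C :=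
    fun h1 h2 h3 => ⟨(h1.trans h2).antisymm h3, h1.antisymm (h2.trans h3)⟩
  refine ⟨fun w₁ w₂ h21 h20 hw hd => hcycle ?_ ?_ ?_, fun hd => hcycle ?_ ?_ ?_⟩
  · intro lam hlam
    have h1 := spectralPolytope_subset (convex_pauliPolytope N d)
      (fun b Γ hΓ => diagVal_mem_pauliPolytope b (fun k => (hweights h21 h20 k).1) hΓ) hlam
    have h2 := spectralPolytope_subset (convex_slaterBound N d ((N : ℝ) - 1 + w₁))
      (fun b Γ hΓ => diagVal_mem_slaterBound b (fun k => (hweights h21 h20 k).1)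
        (h20.trans h21) (fun k => (hweights h21 h20 k).2) hΓ) hlam
    obtain ⟨f, hf, hsum⟩ := topSum_eq_sum_injective (N := N) lam (by omega)
    exact ⟨fun i => (h1.1 i).1, h1.2, (h1.1 _).2, hsum.trans_le (h2 f hf)⟩
  · rintro lam ⟨h0, hs, h1, hN⟩
    exact majorized_twoVertex h21 h20 hw hd _ h0 hs h1 hN
  · intro lam hlam
    exact Majorized.mem_spectralPolytope (antitone_twoVertex h21 h20 hw)
      (twoVertex_comp_mem h21 h20 hw hd) hlam
  -- For `w₁ = 1` the bound on `N` orbitals already follows from Pauli, so `pauliPolytope` suffices.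
  · intro lam hlam
    have h1 := spectralPolytope_subset (convex_pauliPolytope N d)
      (fun b Γ hΓ => diagVal_mem_pauliPolytope b
        (fun k => (hweights zero_le_one le_rfl k).1) hΓ) hlam
    exact ⟨fun i => (h1.1 i).1, h1.2, (h1.1 _).2⟩
  · rintro lam ⟨h0, hs, h1⟩
    exact majorized_oneVertex hd _ h0 hs h1
  · intro lam hlam
    exact Majorized.mem_spectralPolytope antitone_oneVertex (oneVertex_comp_mem hd) hlam
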